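/- Let $\mathcal X$ be a complex Banach space and let $E,A$ be bounded linear operators on $\mathcal X$. Put $\rho(E,A)=\{s\in\mathbb C : sE-A \text{ is bijective}\}$ and $\sigma(E,A)=\mathbb C\setminus\rho(E,A)$. Assume that $E$ is not boundedly invertible, that the pencil $(E,A)$ is regular, i.e. $\rho(E,A)\neq\emptyset$, and that $\dim\ker E<\infty$. For $n\in\mathbb N_0$, the pencil $(E,A)$ is said to have finite index $n$ if $\sigma(E,A)$ is bounded and, as $|s|\to\infty$, $\|(sE-A)^{-1}\|=O(|s|^{n-1})$ but $\|(sE-A)^{-1}\|\neq O(|s|^{n-2})$; it has finite index at most $m$ if it has finite index $n$ for some $n\le m$. Define subspaces $R_k$ by $R_0=\mathcal X$ and $R_{k+1}=A^{-1}(ER_k)=\{x\in\mathcal X : Ax\in ER_k\}$ for $k\ge 0$. A bounded operator $T$ on $\mathcal X$ is Fredholm if $\dim\ker T<\infty$, $\operatorname{ran}T$ is closed and $\dim(\mathcal X/\operatorname{ran}T)<\infty$; its Fredholm index is $\dim\ker T-\dim(\mathcal X/\operatorname{ran}T)$. Then, for every $m\in\mathbb N_0$, the pencil $(E,A)$ has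 finite index at most $m$ if and only if $E$ is Fredholm with Fredholm index zero and $\ker E\cap R_m=\{0\}$. -/

import Mathlib

noncomputable section

namespace OperatorPencil

variable {X : Type*} [NormedAddCommGroup X] [NormedSpace ℂ X]

/-- The resolvent set `ρ(E, A)` of the pencil `s E - A` of bounded operators. -/
def pencilResolventSet (E A : X →L[ℂ] X) : Set ℂ :=
  {s : ℂ | Function.Bijective (s • E - A)}

/-- The (finite) spectrum `σ(E, A)`, the complement of the resolvent set in `ℂ`. -/
def pencilSpectrum (E A : X →L[ℂ] X) : Set ℂ := (pencilResolventSet E A)ᶜ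

/-- The pencil `(E, A)` is regular if its resolvent set is nonempty. -/
def IsRegular (E A : X →L[ℂ] X) : Prop := (pencilResolventSet E A).Nonempty

/-- The resolvent `(s E - A)⁻¹`. On a Banach space it is the true bounded inverse for every `s` in
the resolvent set (bounded inverse theorem); elsewhere it takes the value `0`. -/
def pencilResolvent (E A : X →L[ℂ] X) (s : ℂ) : X →L[ℂ] X := (s • E - A).inverse

/-- The growth condition `‖(s E - A)⁻¹‖ = O(|s| ^ k)` as `|s| → ∞`. -/
def HasResolventGrowth (E A : X →L[ℂ] X) (k : ℤ) : Prop :=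
  (fun s : ℂ => ‖pencilResolvent E A s‖) =O[Bornology.cobounded ℂ] (fun s : ℂ => ‖s‖ ^ k)

/-- The pencil `(E, A)` has finite index `m`: the spectrum is bounded, and the resolvent is
`O(|s| ^ (m - 1))` but not `O(|s| ^ (m - 2))` as `|s| → ∞`. -/
def HasIndex (E A : X →L[ℂ] X) (m : ℕ) : Prop :=
  Bornology.IsBounded (pencilSpectrum E A) ∧
    HasResolventGrowth E A ((m : ℤ) - 1) ∧ ¬ HasResolventGrowth E A ((m : ℤ) - 2)

/-- The pencil `(E, A)` has finite index, and this index is at most `m`. -/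
def HasIndexAtMost (E A : X →L[ℂ] X) (m : ℕ) : Prop :=
  ∃ n ≤ m, HasIndex E A n

/-- The descending Wong sequence: `R 0 = X` and `R (k + 1) = A⁻¹ (E (R k))` (preimage under `A` of
the image under `E`). -/
def wongR (E A : X →L[ℂ] X) : ℕ → Submodule ℂ X
  | 0 => ⊤
  | k + 1 => ((wongR E A k).map (E : X →ₗ[ℂ] X)).comap (A : X →ₗ[ℂ] X)

/-- The Fredholm index `dim ker T - dim (X / ran T)` (meaningful for Fredholm operators `T`). -/
def fredholmIndex (T : X →L[ℂ] X) : ℤ :=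
  (Module.finrank ℂ (LinearMap.ker (T : X →ₗ[ℂ] X)) : ℤ) -
    (Module.finrank ℂ (X ⧸ LinearMap.range (T : X →ₗ[ℂ] X)) : ℤ)

end OperatorPencil

end

/-! ### Preliminaries: contour integrals and ring inverses. -/

open Filter Asymptotics Bornology

/-! Fix `s₀` in the resolvent set and put `u = s₀ E - A`, `T = u⁻¹ E`. Since `(z + s₀) E - A = u (1
+ z T)`, spectrum and growth are read off from `(1 + z T)⁻¹`. Moreover `R_k = ran T ^ k`, and
kernel, Fredholmness and index do not change under left multiplication by a unit. So everything
reduces to the single operator `T` (`isUnit_and_isBigO_iff_isFredholm`).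

The bridge is a Drazin inverse: `d` commuting with `T` such that `p = 1 - T d` satisfies `T ^ m p =
0`. Growth `O(|z| ^ (m - 1))` gives it, because `d` and `p` are the Laurent coefficients of `(1 + z
T)⁻¹` at `z⁻¹` and `z⁰`, and the coefficient `± T ^ m p` of `z ^ m` must vanish. Conversely `(1 + z
T)⁻¹ = ∑_{k < m} (-z) ^ k T ^ k p + d (z + d)⁻¹`.

On the Fredholm side, `ran p ⊆ ker T ^ m` is finite-dimensional, so `d` inverts `T` modulo finite
rank. If `W = ran T ^ m` meets `ker T` trivially, a dimension count shows that the index is zero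
exactly when `T W = W`; then `X = ker T ^ m ⊕ W`, and inverting `T` on `W` produces `d`. -/

theorem ContinuousLinearMap.map_circleIntegral {F G : Type*} [NormedAddCommGroup F]
    [NormedSpace ℂ F] [CompleteSpace F] [NormedAddCommGroup G] [NormedSpace ℂ G] [CompleteSpace G]
    (L : F →L[ℂ] G) {f : ℂ → F} {c : ℂ} {R : ℝ} (hf : CircleIntegrable f c R) :
    L (∮ z in C(c, R), f z) = ∮ z in C(c, R), L (f z) := by
  simp only [circleIntegral]
  rw [← L.intervalIntegral_comp_comm hf.out]
  simp

theorem Commute.ringInverse_right {M₀ : Type*} [MonoidWithZero M₀] {a b : M₀} (h : Commute a b) :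
    Commute a (Ring.inverse b) := by
  by_cases hb : IsUnit b
  · obtain ⟨u, rfl⟩ := hb
    rw [Ring.inverse_unit]
    exact h.units_inv_right
  · rw [Ring.inverse_non_unit b hb]
    exact Commute.zero_right a

/-! ### Growth of `(1 + z t)⁻¹` and Drazin inverses. -/

section BanachAlgebra

variable {𝔸 : Type*} [NormedRing 𝔸] [NormedAlgebra ℂ 𝔸] [CompleteSpace 𝔸]

/-- If `(1 + z t)⁻¹` exists for all large `z` and is `O(|z| ^ (m - 1))`, then `t` is invertible up to
a commuting element annihilated by `t ^ m`. -/
theorem exists_commute_mul_add_eq_one_of_isBigO (t : 𝔸) (m : ℕ)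
    (hu : ∀ᶠ z in cobounded ℂ, IsUnit (1 + z • t))
    (hO : (fun z : ℂ ↦ Ring.inverse (1 + z • t)) =O[cobounded ℂ] fun z ↦ ‖z‖ ^ ((m : ℤ) - 1)) :
    ∃ d p : 𝔸, Commute t d ∧ t * d + p = 1 ∧ t ^ m * p = 0 := by
  obtain ⟨C, hC⟩ := hO.bound
  obtain ⟨r₀, -, hr₀⟩ := (hasBasis_cobounded_norm (E := ℂ)).eventually_iff.1 (hu.and hC)
  set Q : ℂ → 𝔸 := fun z ↦ Ring.inverse (1 + z • t) with hQ
  set r : ℝ := max r₀ 1 with hr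
  have hr1 : 1 ≤ r := le_max_right _ _
  have hunit : ∀ z : ℂ, r ≤ ‖z‖ → IsUnit (1 + z • t) := fun z hz ↦
    (hr₀ (x := z) ((le_max_left _ _).trans hz)).1
  have hbound : ∀ z : ℂ, r ≤ ‖z‖ → ‖Q z‖ ≤ C * ‖z‖ ^ ((m : ℤ) - 1) := fun z hz ↦ by
    simpa using (hr₀ (x := z) ((le_max_left _ _).trans hz)).2
  have hne : ∀ z : ℂ, r ≤ ‖z‖ → z ≠ 0 := fun z hz h ↦ by
    rw [h, norm_zero] at hz; linarith
  have hdiff : ∀ (j : ℤ) (z : ℂ), r ≤ ‖z‖ → DifferentiableAt ℂ (fun z ↦ z ^ j • Q z) z := by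
    intro j z hz
    refine ((differentiableAt_zpow (𝕜 := ℂ)).2 (Or.inl (hne z hz))).smul ?_
    exact DifferentiableAt.inverse (by fun_prop) (hunit z hz)
  have hint : ∀ (j : ℤ) (ρ : ℝ), r ≤ ρ → CircleIntegrable (fun z ↦ z ^ j • Q z) 0 ρ := by
    intro j ρ hρ
    refine ContinuousOn.circleIntegrable (by linarith) fun z hz ↦ ?_
    refine (hdiff j z ?_).continuousAt.continuousWithinAt
    simpa [mem_sphere_zero_iff_norm.1 hz] using hρ
  -- Up to the factor `2πi`, `a j` is the Laurent coefficient of `Q` at `z ^ (-j - 1)`; by Cauchy's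
  -- theorem it does not depend on the radius.
  set a : ℤ → 𝔸 := fun j ↦ ∮ z in C(0, r), z ^ j • Q z with ha
  have ha' : ∀ j ρ, r ≤ ρ → ∮ z in C(0, ρ), z ^ j • Q z = a j := by
    intro j ρ hρ
    refine Complex.circleIntegral_eq_of_differentiable_on_annulus_off_countable (by linarith) hρ
      Set.countable_empty ?_ ?_
    · intro z hz
      exact (hdiff j z (by simpa using hz.2)).continuousAt.continuousWithinAt
    · rintro z ⟨⟨-, hz⟩, -⟩
      exact hdiff j z (by simpa using (le_of_not_ge (by simpa using hz)))
  have hcomm : ∀ j, Commute t (a j) := by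
    intro j
    have h1 := (ContinuousLinearMap.mul ℂ 𝔸 t).map_circleIntegral (hint j r le_rfl)
    have h2 := ((ContinuousLinearMap.mul ℂ 𝔸).flip t).map_circleIntegral (hint j r le_rfl)
    change t * a j = a j * t
    simp only [ContinuousLinearMap.mul_apply', ContinuousLinearMap.flip_apply] at h1 h2
    rw [ha]
    simp only
    rw [h1, h2]
    refine circleIntegral.integral_congr (by linarith) fun z hz ↦ ?_
    have : Commute t (Q z) := Commute.ringInverse_right
      ((Commute.one_right t).add_right ((Commute.refl t).smul_right z))
    simp [this.eq]
  -- Multiply `z t Q = 1 - Q` by `z ^ j` and integrate; the scalar integral survives only for `j =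
  -- -1`.
  have hstep : ∀ j, t * a (j + 1) = (∮ z in C(0, r), z ^ j) • 1 - a j := by
    intro j
    have h1 := (ContinuousLinearMap.mul ℂ 𝔸 t).map_circleIntegral (hint (j + 1) r le_rfl)
    simp only [ContinuousLinearMap.mul_apply'] at h1
    rw [ha]
    simp only
    have hz : CircleIntegrable (fun z : ℂ ↦ z ^ j • (1 : 𝔸)) 0 r := by
      refine ContinuousOn.circleIntegrable (by linarith) fun z hz ↦ ?_
      have : z ≠ 0 := hne z (by simp [mem_sphere_zero_iff_norm.1 hz])
      exact ((continuousAt_id.zpow₀ j (Or.inl this)).smul continuousAt_const).continuousWithinAt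
    rw [h1, ← circleIntegral.integral_smul_const, ← circleIntegral.integral_sub hz (hint j r le_rfl)]
    refine circleIntegral.integral_congr (by linarith) fun z hz ↦ ?_
    have hzr : r ≤ ‖z‖ := by simp [mem_sphere_zero_iff_norm.1 hz]
    have h2 : (1 + z • t) * Q z = 1 := Ring.mul_inverse_cancel _ (hunit z hzr)
    have h3 : z • (t * Q z) = 1 - Q z := by
      rw [eq_sub_iff_add_eq, ← h2]; simp [add_mul, add_comm]
    simp only [mul_smul_comm]
    rw [zpow_add₀ (hne z hzr), zpow_one, mul_smul, h3, smul_sub]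
  have hpow : ∀ k : ℕ, t ^ k * a (-1) = (-1) ^ k * a (-1 - k) := by
    intro k
    induction k with
    | zero => simp
    | succ k ih =>
      have h1 := hstep (-1 - (k + 1 : ℕ))
      have h2 : (∮ z in C(0, r), z ^ (-1 - (k + 1 : ℕ) : ℤ)) = 0 := by
        simpa using circleIntegral.integral_sub_zpow_of_ne
          (n := (-1 - (k + 1 : ℕ) : ℤ)) (by push_cast; omega) 0 0 r
      rw [h2, zero_smul, zero_sub] at h1
      have h3 : (-1 - ((k + 1 : ℕ) : ℤ) + 1) = -1 - (k : ℤ) := by push_cast; ring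
      rw [h3] at h1
      rw [pow_succ', mul_assoc, ih, ← mul_assoc, ((Commute.neg_one_right t).pow_right k).eq,
        mul_assoc, h1, pow_succ, mul_assoc, neg_one_mul]
  -- On the circle of radius `ρ` the integrand is at most `C ρ ^ (-2)` and the length is `2πρ`; let
  -- `ρ → ∞`.
  have hzero : a (-1 - m) = 0 := by
    have key : ∀ ρ, r ≤ ρ → ‖a (-1 - m)‖ ≤ 2 * Real.pi * C * ρ⁻¹ := by
      intro ρ hρ
      have hρ0 : 0 < ρ := by linarith
      rw [← ha' _ ρ hρ]
      have := circleIntegral.norm_integral_le_of_norm_le_const (c := 0) hρ0.le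
        (f := fun z ↦ z ^ (-1 - m : ℤ) • Q z) (C := C * ρ ^ (-2 : ℤ)) ?_
      · refine this.trans_eq ?_
        rw [zpow_neg]; norm_cast; field_simp
      · intro z hz
        have hz' := mem_sphere_zero_iff_norm.1 hz
        have h1 := hbound z (by rw [hz']; exact hρ)
        rw [norm_smul, norm_zpow]
        rw [hz'] at h1 ⊢
        calc ρ ^ (-1 - m : ℤ) * ‖Q z‖ ≤ ρ ^ (-1 - m : ℤ) * (C * ρ ^ ((m : ℤ) - 1)) := by gcongr
          _ = C * (ρ ^ (-1 - m : ℤ) * ρ ^ ((m : ℤ) - 1)) := by ring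
          _ = C * ρ ^ (-2 : ℤ) := by rw [← zpow_add₀ hρ0.ne']; congr 2; ring
    have hlim : Tendsto (fun ρ : ℝ ↦ 2 * Real.pi * C * ρ⁻¹) atTop (nhds 0) := by
      simpa using tendsto_inv_atTop_zero.const_mul (2 * Real.pi * C)
    have := ge_of_tendsto hlim ((eventually_ge_atTop r).mono key)
    exact norm_le_zero_iff.1 this
  have hpi : (2 * Real.pi * Complex.I : ℂ) ≠ 0 := Complex.two_pi_I_ne_zero
  refine ⟨(2 * Real.pi * Complex.I : ℂ)⁻¹ • a 0, (2 * Real.pi * Complex.I : ℂ)⁻¹ • a (-1),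
    (hcomm 0).smul_right _, ?_, ?_⟩
  · have h1 := hstep (-1)
    have h2 : (∮ z in C(0, r), z ^ (-1 : ℤ)) = 2 * Real.pi * Complex.I := by
      simpa using circleIntegral.integral_sub_center_inv 0 (R := r) (by linarith)
    rw [h2] at h1
    norm_num at h1
    rw [mul_smul_comm, ← smul_add, h1, sub_add_cancel, smul_smul, inv_mul_cancel₀ hpi, one_smul]
  · rw [mul_smul_comm, hpow, hzero, mul_zero, smul_zero]

/-- If `d` is a Drazin inverse of `t` with spectral projection `p` and `t ^ m * p = 0`, then
`(1 + z t)⁻¹` exists for all large `z` and is `O(|z| ^ (m - 1))`. -/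
theorem isUnit_and_isBigO_of_drazin (t d p : 𝔸) (m : ℕ) (htd : t * d = 1 - p) (hdt : d * t = 1 - p)
    (hdp : d * p = 0) (htm : t ^ m * p = 0) :
    (∀ᶠ z in cobounded ℂ, IsUnit (1 + z • t)) ∧
      (fun z : ℂ ↦ Ring.inverse (1 + z • t)) =O[cobounded ℂ] fun z ↦ ‖z‖ ^ ((m : ℤ) - 1) := by
  have htp : Commute t p := by
    have : p = 1 - t * d := by rw [htd]; abel
    rw [this]
    refine (Commute.one_right t).sub_right ?_
    rw [Commute, SemiconjBy, mul_assoc, hdt, htd]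
  have hpd : p * d = 0 := by
    have h1 : p = 1 - t * d := by rw [htd]; abel
    have h2 : p = 1 - d * t := by rw [hdt]; abel
    calc p * d = d * (1 - t * d) := by rw [h2]; noncomm_ring
      _ = 0 := by rw [← h1, hdp]
  set W : ℂ → 𝔸 := fun z ↦ resolvent (-d) z with hW
  -- The candidate inverse: a finite geometric series on the nilpotent part `p`, and `t⁻¹ (z +
  -- t⁻¹)⁻¹` with `d` in place of `t⁻¹` on the complementary part.
  set V : ℂ → 𝔸 := fun z ↦ (∑ k ∈ Finset.range m, (-z) ^ k • t ^ k) * p + d * W z with hV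
  have hWunit : ∀ᶠ z in cobounded ℂ, IsUnit (z • (1 : 𝔸) + d) := by
    have := spectrum.eventually_isUnit_resolvent (𝕜 := ℂ) (-d)
    filter_upwards [this] with z hz
    rw [← spectrum.isUnit_resolvent, spectrum.mem_resolventSet_iff, Algebra.algebraMap_eq_smul_one,
      sub_neg_eq_add] at hz
    exact hz
  have hmain : ∀ᶠ z in cobounded ℂ, IsUnit (1 + z • t) ∧ Ring.inverse (1 + z • t) = V z := by
    filter_upwards [hWunit] with z hz
    have hWz : W z = Ring.inverse (z • (1 : 𝔸) + d) := by
      simp only [hW, resolvent, Algebra.algebraMap_eq_smul_one, sub_neg_eq_add]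
    have h1 : (z • (1 : 𝔸) + d) * W z = 1 := by rw [hWz]; exact Ring.mul_inverse_cancel _ hz
    have hpW : z • (p * W z) = p := by
      calc z • (p * W z) = p * ((z • (1 : 𝔸) + d) * W z) := by
            rw [← mul_assoc, mul_add, hpd, add_zero, mul_smul_comm, mul_one, smul_mul_assoc]
        _ = p := by rw [h1, mul_one]
    have hgeom : (1 + z • t) * (∑ k ∈ Finset.range m, (-z) ^ k • t ^ k) = 1 - (-z) ^ m • t ^ m := by
      have := mul_neg_geom_sum ((-z) • t) m
      rw [neg_smul, sub_neg_eq_add, ← neg_smul] at this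
      simpa only [smul_pow] using this
    have hright : (1 + z • t) * V z = 1 := by
      have h2 : (1 + z • t) * (d * W z) = 1 - p := by
        calc (1 + z • t) * (d * W z) = (d + z • (t * d)) * W z := by
              rw [← mul_assoc, add_mul, one_mul, smul_mul_assoc]
          _ = (z • (1 : 𝔸) + d) * W z - z • (p * W z) := by
              rw [htd, smul_sub, ← smul_mul_assoc, ← sub_mul]; congr 1; abel
          _ = 1 - p := by rw [h1, hpW]
      rw [hV]
      simp only
      rw [mul_add, h2, ← mul_assoc, hgeom, sub_mul, smul_mul_assoc, htm]
      simp
    have hcd : Commute t d := by rw [Commute, SemiconjBy, htd, hdt]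
    have hcW : Commute t (W z) := by
      rw [hWz]
      exact Commute.ringInverse_right (((Commute.one_right t).smul_right z).add_right hcd)
    have hcV : Commute t (V z) := by
      refine (Commute.mul_right (Commute.sum_right _ _ _ fun k _ ↦ ?_) htp).add_right
        (hcd.mul_right hcW)
      exact ((Commute.refl t).pow_right k).smul_right _
    have hleft : V z * (1 + z • t) = 1 := by
      refine Eq.trans ?_ hright
      exact (((Commute.one_right (V z)).add_right (hcV.symm.smul_right z))).eq
    let u : 𝔸ˣ := ⟨1 + z • t, V z, hright, hleft⟩
    exact ⟨u.isUnit, Ring.inverse_unit u⟩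
  refine ⟨hmain.mono fun _ h ↦ h.1, ?_⟩
  refine IsBigO.congr' (f₁ := V) ?_ (hmain.mono fun _ h ↦ h.2.symm) EventuallyEq.rfl
  have hle : ∀ i j : ℤ, i ≤ j →
      (fun z : ℂ ↦ ‖z‖ ^ i) =O[cobounded ℂ] fun z ↦ ‖z‖ ^ j := by
    intro i j hij
    refine IsBigO.of_bound 1 ?_
    filter_upwards [(hasBasis_cobounded_norm (E := ℂ)).mem_of_mem (i := 1) trivial] with z hz
    have hz1 : 1 ≤ ‖z‖ := hz
    simpa using zpow_le_zpow_right₀ hz1 hij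
  refine IsBigO.add ?_ ?_
  · refine IsBigO.congr_left (f₁ := fun z : ℂ ↦ ∑ k ∈ Finset.range m, ((-z) ^ k • (t ^ k * p))) ?_
      fun z ↦ by simp [Finset.sum_mul]
    refine IsBigO.fun_sum fun k hk ↦ ?_
    have hk := Finset.mem_range.1 hk
    refine IsBigO.trans ?_ (hle k _ (by omega))
    refine IsBigO.of_bound ‖t ^ k * p‖ (Eventually.of_forall fun z ↦ ?_)
    rw [norm_smul, mul_comm]
    simp
  · have hWO : W =O[cobounded ℂ] fun z ↦ ‖z‖ ^ (-1 : ℤ) := by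
      have := spectrum.resolvent_isBigO_inv (𝕜 := ℂ) (-d)
      refine this.trans (IsBigO.of_bound 1 (Eventually.of_forall fun z ↦ ?_))
      simp
    refine IsBigO.trans ?_ (hWO.trans (hle _ _ (by omega)))
    exact IsBigO.of_bound ‖d‖ (Eventually.of_forall fun z ↦ norm_mul_le _ _)

end BanachAlgebra

/-! ### Codimensions, and kernels and ranges of powers. -/

section LinearAlgebra

variable {K V : Type*} [Field K] [AddCommGroup V] [Module K V]

/-- `T` induces a map `V ⧸ W → V ⧸ T W` whose cokernel is `V ⧸ ran T` and whose kernel is the image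
of `ker T`, a faithful copy when `ker T ⊓ W = ⊥`. Rank-nullity does the rest. -/
theorem Submodule.finiteDimensional_quotient_map (T : V →ₗ[K] V) (W : Submodule K V)
    [FiniteDimensional K (V ⧸ W)] [FiniteDimensional K (V ⧸ LinearMap.range T)] :
    FiniteDimensional K (V ⧸ W.map T) ∧
    (LinearMap.ker T ⊓ W = ⊥ → Module.finrank K (V ⧸ W.map T) + Module.finrank K (LinearMap.ker T) =
      Module.finrank K (V ⧸ LinearMap.range T) + Module.finrank K (V ⧸ W)) := by
  let f : (V ⧸ W) →ₗ[K] (V ⧸ W.map T) := W.mapQ (W.map T) T (W.le_comap_map T)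
  have hf : LinearMap.range f = (LinearMap.range T).map (W.map T).mkQ := by
    rw [Submodule.range_mapQ]
  have e : ((V ⧸ W.map T) ⧸ LinearMap.range f) ≃ₗ[K] V ⧸ LinearMap.range T := by
    rw [hf]
    exact Submodule.quotientQuotientEquivQuotient _ _ LinearMap.map_le_range
  have hq : FiniteDimensional K ((V ⧸ W.map T) ⧸ LinearMap.range f) := e.symm.finiteDimensional
  have hfin : FiniteDimensional K (V ⧸ W.map T) :=
    Module.Finite.of_submodule_quotient (LinearMap.range f)
  refine ⟨hfin, fun hW ↦ ?_⟩
  have hker : LinearMap.ker f = (LinearMap.ker T).map W.mkQ := by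
    rw [Submodule.ker_mapQ, Submodule.comap_map_eq, Submodule.map_sup, Submodule.mkQ_map_self,
      bot_sup_eq]
  have hinj : Function.Injective (W.mkQ.domRestrict (LinearMap.ker T)) := by
    rw [← LinearMap.ker_eq_bot, LinearMap.ker_domRestrict, ← Submodule.disjoint_iff_comap_eq_bot,
      Submodule.ker_mkQ, disjoint_iff, hW]
  have h1 : Module.finrank K (LinearMap.ker f) = Module.finrank K (LinearMap.ker T) := by
    rw [hker, ← LinearMap.range_domRestrict]
    exact LinearMap.finrank_range_of_inj hinj
  have h2 := f.finrank_range_add_finrank_ker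
  have h3 := (LinearMap.range f).finrank_quotient_add_finrank
  rw [e.finrank_eq] at h3
  omega

theorem Submodule.eq_of_le_of_finrank_quotient_eq {W W' : Submodule K V}
    [FiniteDimensional K (V ⧸ W)] (hle : W ≤ W')
    (h : Module.finrank K (V ⧸ W) = Module.finrank K (V ⧸ W')) : W = W' := by
  have : FiniteDimensional K (V ⧸ W') := Submodule.CoFG.of_le hle inferInstance
  have hsurj : Function.Surjective (Submodule.factor hle) := Submodule.factor_surjective hle
  have hinj := (LinearMap.injective_iff_surjective_of_finrank_eq_finrank h).2 hsurj
  refine le_antisymm hle fun x hx ↦ ?_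
  rw [← Submodule.Quotient.mk_eq_zero]
  apply hinj
  simpa using hx

theorem LinearMap.finiteDimensional_ker_pow (T : V →ₗ[K] V)
    (hT : FiniteDimensional K (LinearMap.ker T)) (k : ℕ) :
    FiniteDimensional K (LinearMap.ker (T ^ k)) := by
  induction k with
  | zero => rw [pow_zero, Module.End.one_eq_id, LinearMap.ker_id]; infer_instance
  | succ k ih =>
    refine Module.Finite.iff_fg.2 (Submodule.fg_of_fg_map_of_fg_inf_ker T ?_ ?_)
    · refine Module.Finite.iff_fg.1 (Submodule.finiteDimensional_of_le (S₂ := LinearMap.ker (T ^ k)) ?_)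
      rintro _ ⟨x, hx, rfl⟩
      simpa [pow_succ] using hx
    · exact Module.Finite.iff_fg.1
        (Submodule.finiteDimensional_of_le (S₂ := LinearMap.ker T) inf_le_right)

theorem LinearMap.map_range_pow (T : V →ₗ[K] V) (k : ℕ) :
    (LinearMap.range (T ^ k)).map T = LinearMap.range (T ^ (k + 1)) := by
  rw [pow_succ', Module.End.mul_eq_comp, LinearMap.range_comp]

theorem LinearMap.range_pow_succ_le (T : V →ₗ[K] V) (k : ℕ) :
    LinearMap.range (T ^ (k + 1)) ≤ LinearMap.range (T ^ k) := by
  rw [pow_succ, Module.End.mul_eq_comp]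
  exact LinearMap.range_comp_le_range _ _

/-- If the kernel of `T` meets the `T`-stable subspace `W = range (T ^ m)` trivially and `T` maps
`W` onto itself, then `V` is the direct sum of `ker (T ^ m)` and `W`. -/
theorem LinearMap.isCompl_ker_pow_range_pow (T : V →ₗ[K] V) (m : ℕ)
    (h : LinearMap.ker T ⊓ LinearMap.range (T ^ m) = ⊥)
    (hW : (LinearMap.range (T ^ m)).map T = LinearMap.range (T ^ m)) :
    IsCompl (LinearMap.ker (T ^ m)) (LinearMap.range (T ^ m)) := by
  set W := LinearMap.range (T ^ m) with hWdef
  have hinj : ∀ x ∈ W, T x = 0 → x = 0 := fun x hx hTx ↦ by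
    have : x ∈ LinearMap.ker T ⊓ W := ⟨hTx, hx⟩
    rwa [h, Submodule.mem_bot] at this
  have hmap : ∀ x ∈ W, T x ∈ W := fun x hx ↦ hW ▸ Submodule.mem_map_of_mem hx
  have hinj' : ∀ k : ℕ, ∀ x ∈ W, (T ^ k) x = 0 → x = 0 := by
    intro k
    induction k with
    | zero => intro x _ h; simpa using h
    | succ k ih =>
      intro x hx h
      rw [pow_succ, Module.End.mul_apply] at h
      exact hinj x hx (ih _ (hmap x hx) h)
  have hsurj : ∀ k : ℕ, ∀ x ∈ W, ∃ y ∈ W, (T ^ k) y = x := by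
    intro k
    induction k with
    | zero => intro x hx; exact ⟨x, hx, by simp⟩
    | succ k ih =>
      intro x hx
      obtain ⟨y, hy, rfl⟩ := ih x hx
      rw [← hW] at hy
      obtain ⟨z, hz, rfl⟩ := hy
      exact ⟨z, hz, by rw [pow_succ, Module.End.mul_apply]⟩
  refine ⟨?_, ?_⟩
  · rw [Submodule.disjoint_def]
    exact fun x hx hxW ↦ hinj' m x hxW hx
  · rw [codisjoint_iff, eq_top_iff]
    intro x _
    obtain ⟨y, hy, hyx⟩ := hsurj m ((T ^ m) x) ⟨x, rfl⟩
    rw [Submodule.mem_sup]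
    exact ⟨x - y, by simp [hyx], y, hy, by simp⟩

end LinearAlgebra

/-! ### Fredholm operators of index zero and Drazin inverses. -/

open LinearMap.FiniteRangeSetoid in
theorem ContinuousLinearMap.IsFredholm.pow {X : Type*} [NormedAddCommGroup X] [NormedSpace ℂ X]
    {T : X →L[ℂ] X} (hT : T.IsFredholm) (k : ℕ) : (T ^ k).IsFredholm := by
  obtain ⟨v, hv⟩ := hT.exists_isQuasiInverse
  refine IsFredholm.of_isQuasiInverse (v := v ^ k) ?_
  induction k with
  | zero => exact (LinearEquiv.refl ℂ X).isQuasiInverse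
  | succ k ih =>
    rw [pow_succ' T, pow_succ v]
    exact ih.comp hv

open LinearMap.FiniteRangeSetoid in
theorem ContinuousLinearMap.IsFredholm.of_mul_eq_one_sub {X : Type*} [NormedAddCommGroup X]
    [NormedSpace ℂ X] {T d p : X →L[ℂ] X} (htd : T * d = 1 - p) (hdt : d * T = 1 - p)
    (hp : FiniteDimensional ℂ (LinearMap.range (p : X →ₗ[ℂ] X))) : T.IsFredholm := by
  have hfin : (p : X →ₗ[ℂ] X).HasFiniteRange := LinearMap.hasFiniteRange_iff_range.2
    (Module.Finite.iff_fg.1 hp)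
  have aux : ∀ a b : X →L[ℂ] X, a * b = 1 - p → (a : X →ₗ[ℂ] X) ∘ₗ (b : X →ₗ[ℂ] X) ≈ LinearMap.id := by
    intro a b hab
    rw [LinearMap.FiniteRangeSetoid.equiv_iff_hasFiniteRange]
    have : (a : X →ₗ[ℂ] X) ∘ₗ (b : X →ₗ[ℂ] X) - LinearMap.id = -(p : X →ₗ[ℂ] X) := by
      ext x
      have h : a (b x) = x - p x := congrArg (fun f : X →L[ℂ] X ↦ f x) hab
      simp [h]
    rw [this]
    exact hfin.neg
  exact IsFredholm.of_isQuasiInverse (v := d) ⟨aux d T hdt, aux T d htd⟩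

namespace OperatorPencil

variable {X : Type*} [NormedAddCommGroup X] [NormedSpace ℂ X]

/-- With `W = ran T ^ m`, the dimension count makes the index equal to `codim T W - codim W`; as `T
W ⊆ W` and the codimensions are finite, it vanishes only for equality. -/
theorem fredholmIndex_eq_zero_iff_map_range_pow {T : X →L[ℂ] X} (hT : T.IsFredholm) {m : ℕ}
    (hm : LinearMap.ker (T : X →ₗ[ℂ] X) ⊓ LinearMap.range ((T : X →ₗ[ℂ] X) ^ m) = ⊥) :
    fredholmIndex T = 0 ↔ (LinearMap.range ((T : X →ₗ[ℂ] X) ^ m)).map (T : X →ₗ[ℂ] X) =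
      LinearMap.range ((T : X →ₗ[ℂ] X) ^ m) := by
  have := hT.finite_ker
  have : FiniteDimensional ℂ (X ⧸ LinearMap.range (T : X →ₗ[ℂ] X)) := hT.finite_coker
  have : FiniteDimensional ℂ (X ⧸ LinearMap.range ((T : X →ₗ[ℂ] X) ^ m)) := by
    rw [← ContinuousLinearMap.toLinearMap_pow]
    exact (hT.pow m).finite_coker
  obtain ⟨hfin, hrank⟩ := Submodule.finiteDimensional_quotient_map (T : X →ₗ[ℂ] X)
    (LinearMap.range ((T : X →ₗ[ℂ] X) ^ m))
  have hrank := hrank hm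
  rw [fredholmIndex]
  constructor
  · intro h
    refine Submodule.eq_of_le_of_finrank_quotient_eq ?_ (by omega)
    rw [LinearMap.map_range_pow]
    exact LinearMap.range_pow_succ_le _ _
  · intro h
    rw [h] at hrank
    omega

theorem isFredholm_of_commute {T d p : X →L[ℂ] X} {m : ℕ}
    (hker : FiniteDimensional ℂ (LinearMap.ker (T : X →ₗ[ℂ] X)))
    (hcomm : Commute T d) (hsum : T * d + p = 1) (hp : T ^ m * p = 0) :
    T.IsFredholm ∧ fredholmIndex T = 0 ∧
      LinearMap.ker (T : X →ₗ[ℂ] X) ⊓ LinearMap.range ((T : X →ₗ[ℂ] X) ^ m) = ⊥ := by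
  have htd : T * d = 1 - p := by rw [← hsum]; abel
  have hpfin : FiniteDimensional ℂ (LinearMap.range (p : X →ₗ[ℂ] X)) := by
    have := LinearMap.finiteDimensional_ker_pow (T : X →ₗ[ℂ] X) hker m
    refine Submodule.finiteDimensional_of_le (S₂ := LinearMap.ker ((T : X →ₗ[ℂ] X) ^ m)) ?_
    rintro _ ⟨x, rfl⟩
    have := congrArg (fun f : X →L[ℂ] X ↦ f x) hp
    rw [← ContinuousLinearMap.toLinearMap_pow]
    exact this
  have hF : T.IsFredholm := .of_mul_eq_one_sub htd (hcomm.eq ▸ htd) hpfin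
  -- This identity yields both remaining claims: moving `d` to the left shows that `T ^ m y`
  -- vanishes once `T ^ (m + 1) y` does, and reading it as `T ^ (m + 1) d` shows that the ranges
  -- stabilise.
  have hpow : T ^ m = T ^ m * (T * d) := by
    rw [htd, mul_sub, hp, mul_one, sub_zero]
  have hpow' : ∀ y, (T ^ m) y = (T ^ m) (T (d y)) := fun y ↦
    congrArg (fun f : X →L[ℂ] X ↦ f y) hpow
  have hbot : LinearMap.ker (T : X →ₗ[ℂ] X) ⊓ LinearMap.range ((T : X →ₗ[ℂ] X) ^ m) = ⊥ := by
    rw [eq_bot_iff, ← ContinuousLinearMap.toLinearMap_pow]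
    rintro _ ⟨hx, y, rfl⟩
    have hx' : T ((T ^ m) y) = 0 := hx
    have h1 : T ^ m * (T * d) = d * (T * T ^ m) := by
      rw [← pow_succ', ← mul_assoc, ← pow_succ, (hcomm.pow_left (m + 1)).eq]
    have h2 : (T ^ m) (T (d y)) = d (T ((T ^ m) y)) :=
      congrArg (fun f : X →L[ℂ] X ↦ f y) h1
    change (T ^ m) y ∈ (⊥ : Submodule ℂ X)
    rw [Submodule.mem_bot, hpow', h2, hx', map_zero]
  refine ⟨hF, (fredholmIndex_eq_zero_iff_map_range_pow hF hbot).2 ?_, hbot⟩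
  rw [LinearMap.map_range_pow]
  refine le_antisymm (LinearMap.range_pow_succ_le _ _) ?_
  rw [← ContinuousLinearMap.toLinearMap_pow, ← ContinuousLinearMap.toLinearMap_pow]
  rintro _ ⟨y, rfl⟩
  exact ⟨d y, ((hpow' y).trans (by rw [pow_succ]; rfl)).symm⟩

/-- The projection onto `ker T ^ m` along `ran T ^ m` is bounded, since the kernel is
finite-dimensional and the range is closed (`T ^ m` is Fredholm). -/
theorem exists_drazin_of_isFredholm [CompleteSpace X] {T : X →L[ℂ] X} {m : ℕ}
    (hT : T.IsFredholm) (hindex : fredholmIndex T = 0)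
    (hm : LinearMap.ker (T : X →ₗ[ℂ] X) ⊓ LinearMap.range ((T : X →ₗ[ℂ] X) ^ m) = ⊥) :
    ∃ d p : X →L[ℂ] X, T * d = 1 - p ∧ d * T = 1 - p ∧ d * p = 0 ∧ T ^ m * p = 0 := by
  have hW := (fredholmIndex_eq_zero_iff_map_range_pow hT hm).1 hindex
  have hcompl := LinearMap.isCompl_ker_pow_range_pow _ m hm hW
  have hpow : (T : X →ₗ[ℂ] X) ^ m = ((T ^ m : X →L[ℂ] X) : X →ₗ[ℂ] X) :=
    (ContinuousLinearMap.toLinearMap_pow T m).symm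
  set N := LinearMap.ker ((T : X →ₗ[ℂ] X) ^ m) with hN
  set W := LinearMap.range ((T : X →ₗ[ℂ] X) ^ m) with hWdef
  have hWclosed : IsClosed (W : Set X) := by
    rw [hWdef, hpow]; exact (hT.pow m).isClosed_range
  have hNfin : FiniteDimensional ℂ N := LinearMap.finiteDimensional_ker_pow _ hT.finite_ker m
  have htop : Submodule.IsTopCompl N W :=
    (Submodule.IsCompl.isTopCompl_of_isClosed_of_finiteDimensional hcompl.symm hWclosed).symm
  set p : X →L[ℂ] X := N.projectionL W htop with hp
  have hpN : ∀ x ∈ N, p x = x := fun x hx ↦ Submodule.projectionL_apply_left htop ⟨x, hx⟩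
  have hpW : ∀ x ∈ W, p x = 0 := fun x hx ↦ Submodule.projectionL_apply_right htop ⟨x, hx⟩
  have hpmem : ∀ x, p x ∈ N := fun x ↦ Submodule.projectionL_apply_mem htop x
  have hpmem' : ∀ x, x - p x ∈ W := fun x ↦ by
    rw [← Submodule.projectionL_apply_eq_zero_iff htop, ← hp, map_sub, hpN _ (hpmem x), sub_self]
  have hTN : ∀ x ∈ N, T x ∈ N := fun x hx ↦ by
    rw [hN, LinearMap.mem_ker] at hx ⊢
    have : ((T : X →ₗ[ℂ] X) ^ m) ((T : X →ₗ[ℂ] X) x) = (T : X →ₗ[ℂ] X) (((T : X →ₗ[ℂ] X) ^ m) x) := by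
      rw [← Module.End.mul_apply, ← pow_succ, pow_succ', Module.End.mul_apply]
    change ((T : X →ₗ[ℂ] X) ^ m) ((T : X →ₗ[ℂ] X) x) = 0
    rw [this, hx, map_zero]
  have hTW : ∀ x ∈ W, T x ∈ W := fun x hx ↦ hW ▸ Submodule.mem_map_of_mem hx
  have hpp : p * p = p := by ext x; exact hpN _ (hpmem x)
  have hcomm : p * T = T * p := by
    ext x
    have h1 : T x = T (p x) + T (x - p x) := by rw [← map_add]; congr 1; abel
    change p (T x) = T (p x)
    rw [h1, map_add, hpN _ (hTN _ (hpmem x)), hpW _ (hTW _ (hpmem' x)), add_zero]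
  have htm : T ^ m * p = 0 := by
    ext x
    have := hpmem x
    rw [hN, hpow] at this
    exact this
  -- `S` is `T` on `W` and the identity on `N`, hence bijective; `S⁻¹ (1 - p)` is then a bounded
  -- inverse of `T` on `W`, extended by zero to `N`.
  set S : X →L[ℂ] X := T * (1 - p) + p with hS
  have hSx : ∀ x, S x = T (x - p x) + p x := fun x ↦ rfl
  have hSbij : Function.Bijective S := by
    constructor
    · rw [injective_iff_map_eq_zero]
      intro x hx
      rw [hSx] at hx
      have h1 : p x = 0 := by
        have := congrArg p hx
        rwa [map_add, hpW _ (hTW _ (hpmem' x)), zero_add, hpN _ (hpmem x), map_zero] at this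
      rw [h1, sub_zero, add_zero] at hx
      have h2 := hpmem' x
      rw [h1, sub_zero] at h2
      have h3 : x ∈ LinearMap.ker (T : X →ₗ[ℂ] X) ⊓ W := ⟨hx, h2⟩
      rwa [hm, Submodule.mem_bot] at h3
    · intro y
      have h1 := hpmem' y
      rw [← hW] at h1
      obtain ⟨w, hw, hwy⟩ := h1
      have hwy : T w = y - p y := hwy
      refine ⟨w + p y, ?_⟩
      rw [hSx, map_add, hpW w hw, hpN _ (hpmem y), zero_add, add_sub_cancel_right, hwy,
        sub_add_cancel]
  obtain ⟨u, hu⟩ := ContinuousLinearMap.isUnit_iff_bijective.2 hSbij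
  have hSp : Commute S p := by
    change S * p = p * S
    rw [hS, add_mul, mul_add, ← mul_assoc, hcomm, mul_assoc, sub_mul, one_mul, hpp, mul_assoc,
      mul_sub p, mul_one, hpp]
  have hup : Commute (↑u⁻¹ : X →L[ℂ] X) p := by
    rw [← hu] at hSp
    exact hSp.units_inv_left
  have hTp : T * (1 - p) = S * (1 - p) := by
    rw [hS, add_mul, mul_assoc, mul_sub p, mul_one, hpp, sub_self, add_zero, mul_sub (1 - p),
      mul_one, sub_mul, one_mul, hpp, sub_self, sub_zero]
  have hpT : (1 - p) * T = T * (1 - p) := by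
    rw [sub_mul, mul_sub, hcomm, one_mul, mul_one]
  have hu1 : Commute (↑u⁻¹ : X →L[ℂ] X) (1 - p) := (Commute.one_right _).sub_right hup
  refine ⟨↑u⁻¹ * (1 - p), p, ?_, ?_, ?_, htm⟩
  · rw [hu1.eq, ← mul_assoc, hTp, ← hu, mul_assoc, ← hu1.eq, Units.mul_inv_cancel_left]
  · rw [mul_assoc, hpT, hTp, ← hu, Units.inv_mul_cancel_left]
  · rw [mul_assoc, sub_mul, one_mul, hpp, sub_self, mul_zero]

theorem isUnit_and_isBigO_iff_isFredholm [CompleteSpace X] {T : X →L[ℂ] X}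
    (hker : FiniteDimensional ℂ (LinearMap.ker (T : X →ₗ[ℂ] X))) (m : ℕ) :
    ((∀ᶠ z in cobounded ℂ, IsUnit (1 + z • T)) ∧
      (fun z : ℂ ↦ Ring.inverse (1 + z • T)) =O[cobounded ℂ] fun z ↦ ‖z‖ ^ ((m : ℤ) - 1)) ↔
    T.IsFredholm ∧ fredholmIndex T = 0 ∧
      LinearMap.ker (T : X →ₗ[ℂ] X) ⊓ LinearMap.range ((T : X →ₗ[ℂ] X) ^ m) = ⊥ := by
  constructor
  · rintro ⟨hu, hO⟩
    obtain ⟨d, p, hcomm, hsum, hp⟩ := exists_commute_mul_add_eq_one_of_isBigO T m hu hO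
    exact isFredholm_of_commute hker hcomm hsum hp
  · rintro ⟨hF, hindex, hm⟩
    obtain ⟨d, p, htd, hdt, hdp, htm⟩ := exists_drazin_of_isFredholm hF hindex hm
    exact isUnit_and_isBigO_of_drazin T d p m htd hdt hdp htm

end OperatorPencil

/-! ### Reduction of the pencil to one operator. -/

namespace OperatorPencil

variable {X : Type*} [NormedAddCommGroup X] [NormedSpace ℂ X]

theorem ker_units_mul (u : (X →L[ℂ] X)ˣ) (T : X →L[ℂ] X) :
    LinearMap.ker ((↑u * T : X →L[ℂ] X) : X →ₗ[ℂ] X) = LinearMap.ker (T : X →ₗ[ℂ] X) := by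
  ext x
  change (u : X →L[ℂ] X) (T x) = 0 ↔ T x = 0
  refine ⟨fun h ↦ ?_, fun h ↦ by rw [h, map_zero]⟩
  have h1 : (↑u⁻¹ * ↑u : X →L[ℂ] X) (T x) = T x := by rw [Units.inv_mul]; rfl
  rw [← h1]
  change (↑u⁻¹ : X →L[ℂ] X) ((u : X →L[ℂ] X) (T x)) = 0
  rw [h, map_zero]

theorem fredholmIndex_units_mul (u : (X →L[ℂ] X)ˣ) (T : X →L[ℂ] X) :
    fredholmIndex (↑u * T : X →L[ℂ] X) = fredholmIndex T := by
  have h1 := ker_units_mul u T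
  let e : X ≃ₗ[ℂ] X := (ContinuousLinearEquiv.ofUnit u).toLinearEquiv
  have h2 : (LinearMap.range (T : X →ₗ[ℂ] X)).map (e : X →ₗ[ℂ] X) =
      LinearMap.range ((↑u * T : X →L[ℂ] X) : X →ₗ[ℂ] X) := by
    rw [← LinearMap.range_comp]; rfl
  rw [fredholmIndex, fredholmIndex, h1, (Submodule.Quotient.equiv _ _ e h2).finrank_eq]

theorem isFredholm_units_mul {u : (X →L[ℂ] X)ˣ} {T : X →L[ℂ] X} (hT : T.IsFredholm) :
    (↑u * T : X →L[ℂ] X).IsFredholm := by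
  obtain ⟨v, hv⟩ := hT.exists_isQuasiInverse
  have := hv.comp (ContinuousLinearEquiv.ofUnit u).toLinearEquiv.isQuasiInverse
  exact ContinuousLinearMap.IsFredholm.of_isQuasiInverse (v := v * (↑u⁻¹ : X →L[ℂ] X)) this

theorem isFredholm_units_mul_iff {u : (X →L[ℂ] X)ˣ} {T : X →L[ℂ] X} :
    (↑u * T : X →L[ℂ] X).IsFredholm ↔ T.IsFredholm :=
  ⟨fun h ↦ by simpa using isFredholm_units_mul (u := u⁻¹) h, isFredholm_units_mul⟩

/-- If `u = s E - A` is invertible, the Wong sequence consists of the ranges of the powers of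
`(s E - A)⁻¹ E`. -/
theorem wongR_eq_range_pow {E A : X →L[ℂ] X} {s : ℂ} {u : (X →L[ℂ] X)ˣ} (hu : ↑u = s • E - A)
    (k : ℕ) : wongR E A k = LinearMap.range (((↑u⁻¹ * E : X →L[ℂ] X) : X →ₗ[ℂ] X) ^ k) := by
  set T : X →L[ℂ] X := ↑u⁻¹ * E with hT
  have hE : ∀ x, E x = u.1 (T x) := fun x ↦ by
    have : (↑u * T : X →L[ℂ] X) = E := by rw [hT, Units.mul_inv_cancel_left]
    exact congrArg (fun f : X →L[ℂ] X ↦ f x) this.symm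
  have hA : ∀ x, A x = u.1 (s • T x - x) := fun x ↦ by
    rw [map_sub, map_smul, ← hE, hu]
    simp
  have hinj : Function.Injective u.1 := (ContinuousLinearEquiv.ofUnit u).injective
  induction k with
  | zero => rw [pow_zero, Module.End.one_eq_id, LinearMap.range_id]; rfl
  | succ k ih =>
    have hle := LinearMap.range_pow_succ_le (T : X →ₗ[ℂ] X) k
    rw [← LinearMap.map_range_pow] at hle ⊢
    rw [wongR, ih]
    ext x
    constructor
    · rintro ⟨y, hy, hyx⟩
      have h1 : T y = s • T x - x := hinj (by rw [← hE, ← hA]; exact hyx)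
      -- `A x = E y` amounts to `x = T (s x - y)`. Knowing `x ∈ ran T ^ j` thus gives `x ∈ ran T ^
      -- (j + 1)`, as `y ∈ ran T ^ k`; the induction climbs from `j = 0`.
      have h2 : ∀ j ≤ k, x ∈ LinearMap.range ((T : X →ₗ[ℂ] X) ^ j) →
          x ∈ (LinearMap.range ((T : X →ₗ[ℂ] X) ^ j)).map (T : X →ₗ[ℂ] X) := by
        intro j hj hx
        have hy' : y ∈ LinearMap.range ((T : X →ₗ[ℂ] X) ^ j) := by
          obtain ⟨w, rfl⟩ := hy
          exact ⟨((T : X →ₗ[ℂ] X) ^ (k - j)) w, by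
            rw [← Module.End.mul_apply, ← pow_add, Nat.add_sub_cancel' hj]⟩
        refine ⟨s • x - y, Submodule.sub_mem _ (Submodule.smul_mem _ s hx) hy', ?_⟩
        change T (s • x - y) = x
        rw [map_sub, map_smul, h1, sub_sub_cancel]
      have h3 : ∀ j ≤ k, x ∈ LinearMap.range ((T : X →ₗ[ℂ] X) ^ j) := by
        intro j
        induction j with
        | zero => exact fun _ ↦ ⟨x, rfl⟩
        | succ j ihj =>
          intro hj
          rw [← LinearMap.map_range_pow]
          exact h2 j (by omega) (ihj (by omega))
      exact h2 k le_rfl (h3 k le_rfl)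
    · rintro hx
      have hxk := hle hx
      obtain ⟨y, hy, hyx⟩ := hx
      have hyx : T y = x := hyx
      refine ⟨s • x - y, Submodule.sub_mem _ (Submodule.smul_mem _ s hxk) hy, ?_⟩
      change E (s • x - y) = A x
      rw [hE, hA, map_sub T, map_smul T, hyx]

theorem isTheta_norm_add_const_zpow (c : ℂ) (k : ℤ) :
    (fun z : ℂ ↦ ‖z + c‖ ^ k) =Θ[cobounded ℂ] fun z ↦ ‖z‖ ^ k := by
  refine IsTheta.zpow ?_ k
  refine IsTheta.norm_left (IsTheta.norm_right ?_)
  have : (fun _ : ℂ ↦ c) =o[cobounded ℂ] (id : ℂ → ℂ) :=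
    isLittleO_const_id_cobounded c
  exact (isTheta_refl (id : ℂ → ℂ) (cobounded ℂ)).add_isLittleO this

/-- With `u = s₀ E - A` invertible and `T = (s₀ E - A)⁻¹ E`, boundedness of the spectrum and the
growth of the pencil resolvent are those of `(1 + z T)⁻¹`. -/
theorem isBounded_and_hasResolventGrowth_iff [CompleteSpace X] {E A : X →L[ℂ] X} {s₀ : ℂ}
    {u : (X →L[ℂ] X)ˣ} (hu : ↑u = s₀ • E - A) (k : ℤ) :
    (IsBounded (pencilSpectrum E A) ∧ HasResolventGrowth E A k) ↔
    ((∀ᶠ z in cobounded ℂ, IsUnit (1 + z • (↑u⁻¹ * E))) ∧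
      (fun z : ℂ ↦ Ring.inverse (1 + z • (↑u⁻¹ * E))) =O[cobounded ℂ] fun z ↦ ‖z‖ ^ k) := by
  set T : X →L[ℂ] X := ↑u⁻¹ * E with hT
  have hfac : ∀ z : ℂ, (z + s₀) • E - A = ↑u * (1 + z • T) := fun z ↦ by
    rw [mul_add, mul_smul_comm, hT, Units.mul_inv_cancel_left, mul_one, hu, add_smul]; abel
  have hunit : ∀ z : ℂ, IsUnit ((z + s₀) • E - A) ↔ IsUnit (1 + z • T) := fun z ↦ by
    rw [hfac, Units.isUnit_units_mul]
  have hinv : ∀ z : ℂ, pencilResolvent E A (z + s₀) = Ring.inverse (1 + z • T) * ↑u⁻¹ := fun z ↦ by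
    rw [pencilResolvent, ← ContinuousLinearMap.ringInverse_eq_inverse, hfac,
      Ring.inverse_mul (Or.inl u.isUnit), Ring.inverse_unit]
  have hinv' : ∀ z : ℂ, Ring.inverse (1 + z • T) = pencilResolvent E A (z + s₀) * ↑u := fun z ↦ by
    rw [hinv, mul_assoc, Units.inv_mul, mul_one]
  have htrans : ∀ P : ℂ → Prop,
      (∀ᶠ z in cobounded ℂ, P (z + s₀)) ↔ ∀ᶠ s in cobounded ℂ, P s := fun P ↦
    ⟨fun h ↦ by simpa using (tendsto_add_const_cobounded (-s₀)).eventually h,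
      fun h ↦ (tendsto_add_const_cobounded s₀).eventually h⟩
  have h1 : IsBounded (pencilSpectrum E A) ↔ ∀ᶠ z in cobounded ℂ, IsUnit (1 + z • T) := by
    simp only [← hunit]
    rw [htrans (fun s ↦ IsUnit (s • E - A)), isBounded_def, pencilSpectrum, compl_compl]
    simp only [ContinuousLinearMap.isUnit_iff_bijective]
    rfl
  have h2 : HasResolventGrowth E A k ↔
      (fun z ↦ pencilResolvent E A (z + s₀)) =O[cobounded ℂ] fun z ↦ ‖z‖ ^ k := by
    rw [HasResolventGrowth, isBigO_norm_left]
    refine ⟨fun h ↦ (h.comp_tendsto (tendsto_add_const_cobounded s₀)).trans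
      (isTheta_norm_add_const_zpow s₀ k).1, fun h ↦ ?_⟩
    have := h.comp_tendsto (tendsto_add_const_cobounded (-s₀))
    simp only [Function.comp_def, neg_add_cancel_right] at this
    exact this.trans (isTheta_norm_add_const_zpow (-s₀) k).1
  rw [h1, h2]
  refine and_congr_right fun _ ↦ ⟨fun h ↦ ?_, fun h ↦ ?_⟩
  · refine IsBigO.trans (IsBigO.of_bound ‖(u : X →L[ℂ] X)‖ (Eventually.of_forall fun z ↦ ?_)) h
    rw [hinv', mul_comm ‖_‖]
    exact norm_mul_le _ _
  · refine IsBigO.trans (IsBigO.of_bound ‖(↑u⁻¹ : X →L[ℂ] X)‖ (Eventually.of_forall fun z ↦ ?_)) h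
    rw [hinv, mul_comm ‖_‖]
    exact norm_mul_le _ _

/-- This is the case `m = 0` of the Laurent argument: `T ^ 0 p = 0` forces `p = 0`, so `d` inverts
`T = u⁻¹ E`. -/
theorem isInvertible_of_isBounded_of_hasResolventGrowth [CompleteSpace X] {E A : X →L[ℂ] X}
    (hreg : IsRegular E A) (hb : IsBounded (pencilSpectrum E A))
    (hg : HasResolventGrowth E A (-1)) : E.IsInvertible := by
  obtain ⟨s₀, hs₀⟩ := hreg
  obtain ⟨u, hu⟩ := ContinuousLinearMap.isUnit_iff_bijective.2 hs₀
  obtain ⟨h1, h2⟩ := (isBounded_and_hasResolventGrowth_iff hu (-1)).1 ⟨hb, hg⟩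
  obtain ⟨d, p, hcomm, hsum, hp⟩ := exists_commute_mul_add_eq_one_of_isBigO _ 0 h1 (by simpa using h2)
  rw [pow_zero, one_mul] at hp
  rw [hp, add_zero] at hsum
  have hE : E = ↑u * (↑u⁻¹ * E) := by rw [Units.mul_inv_cancel_left]
  refine ContinuousLinearMap.IsInvertible.of_inverse (g := d * ↑u⁻¹) ?_ ?_
  · change E * (d * ↑u⁻¹) = 1
    rw [hE, mul_assoc, ← mul_assoc _ d, hsum, one_mul, Units.mul_inv]
  · change d * ↑u⁻¹ * E = 1
    rw [mul_assoc, ← hcomm.eq, hsum]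

/-- The index is the least `n` for which the growth bound holds. Minimality gives failure of the
next smaller exponent when `n > 0`; non-invertibility of `E` rules out `n = 0`. -/
theorem hasIndexAtMost_iff [CompleteSpace X] {E A : X →L[ℂ] X} (hE : ¬ E.IsInvertible)
    (hreg : IsRegular E A) (m : ℕ) :
    HasIndexAtMost E A m ↔
      IsBounded (pencilSpectrum E A) ∧ HasResolventGrowth E A ((m : ℤ) - 1) := by
  classical
  constructor
  · rintro ⟨n, hn, hb, hg, -⟩
    refine ⟨hb, hg.trans (IsBigO.of_bound 1 ?_)⟩
    filter_upwards [tendsto_norm_cobounded_atTop.eventually_ge_atTop 1] with z hz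
    simpa using zpow_le_zpow_right₀ hz (by omega : (n : ℤ) - 1 ≤ m - 1)
  · rintro ⟨hb, hg⟩
    have hex : ∃ n : ℕ, HasResolventGrowth E A ((n : ℤ) - 1) := ⟨m, hg⟩
    refine ⟨Nat.find hex, Nat.find_min' hex hg, hb, Nat.find_spec hex, fun h ↦ ?_⟩
    obtain h0 | ⟨n, hn⟩ : Nat.find hex = 0 ∨ ∃ n, Nat.find hex = n + 1 := by
      cases Nat.find hex <;> simp
    · have := Nat.find_spec hex
      rw [h0] at this
      exact hE (isInvertible_of_isBounded_of_hasResolventGrowth hreg hb (by simpa using this))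
    · refine Nat.find_min hex (m := n) (by omega) ?_
      rw [hn] at h
      convert h using 1
      push_cast
      ring

end OperatorPencil

theorem mainTheorem9 {X : Type*} [NormedAddCommGroup X] [NormedSpace ℂ X] [CompleteSpace X]
    (E A : X →L[ℂ] X)
    (hE : ¬ E.IsInvertible)
    (hreg : OperatorPencil.IsRegular E A)
    (hker : FiniteDimensional ℂ (LinearMap.ker (E : X →ₗ[ℂ] X)))
    (m : ℕ) :
    OperatorPencil.HasIndexAtMost E A m ↔
      E.IsFredholm ∧ OperatorPencil.fredholmIndex E = 0 ∧
        LinearMap.ker (E : X →ₗ[ℂ] X) ⊓ OperatorPencil.wongR E A m = ⊥ := by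
  rw [OperatorPencil.hasIndexAtMost_iff hE hreg]
  obtain ⟨s₀, hs₀⟩ := hreg
  obtain ⟨u, hu⟩ := ContinuousLinearMap.isUnit_iff_bijective.2 hs₀
  have hk := OperatorPencil.ker_units_mul u⁻¹ E
  rw [OperatorPencil.isBounded_and_hasResolventGrowth_iff hu,
    OperatorPencil.isUnit_and_isBigO_iff_isFredholm (hk ▸ hker) m,
    OperatorPencil.isFredholm_units_mul_iff, OperatorPencil.fredholmIndex_units_mul, hk,
    OperatorPencil.wongR_eq_range_pow hu]
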